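/- Let $\Bbbk\in\{\mathbb R,\mathbb C\}$, let $1<n_1<n_2<n_3$ be integers, let $A_1,A_2,A_3\in\Bbbk[t]$ be nonzero polynomials with degrees $a_i=\deg A_i$ and leading coefficients $\alpha_i$, and consider $$x'=A_3(t)x^{n_3}+A_2(t)x^{n_2}+A_1(t)x^{n_1}.\qquad(\ast)$$ **Notation.** For an integer $r\ge 1$ put $\Phi_i(r)=n_ir-a_i$ ($i=1,2,3$) and $\Phi_\partial(r)=r+1$, and let $T_r\subseteq\{3,2,1,\partial\}$ be the set of indices $\ell$ at which $\Phi_\ell(r)$ is minimal. Call $r$ edge-admissible if $|T_r|\ge 2$; then let $$P_r(C)=\sum_{i\in T_r\cap\{1,2,3\}}\alpha_iC^{n_i}+\mathbf 1_{\{\partial\in T_r\}}\,rC,\qquad \widetilde P_r(C)=P_r(C)/C^{e_r},$$ where $e_r$ is the multiplicity of $0$ as a root of $P_r$. Let $\Gamma$ be the set of positive integers $r\le a_3/(n_3-n_2)$ that are equal to one of $\frac{a_3-a_2}{n_3-n_2}$, $\frac{a_3-a_1}{n_3-n_1}$, $\frac{a_2-a_1}{n_2-n_1}$, $\frac{a_3+1}{n_3-1}$,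 $\frac{a_2+1}{n_2-1}$, $\frac{a_1+1}{n_1-1}$. **Hypothesis (ND).** For every edge-admissible $r\in\Gamma$: 1. $\operatorname{Res}_C(\widetilde P_r,\widetilde P_r')\ne 0$; 2. if $\partial\in T_r$, then $P_r'(C)$ is not a negative integer for any nonzero root $C\in\Bbbk$ of $P_r$; 3. $\operatorname{Res}_C\big(\widetilde P_r(C),\widetilde P_r(C/\zeta)\big)\neq 0$ for every $\zeta\in\Bbbk$, $\zeta\ne1$, with $\zeta^{n_3-n_2}=1$ or $\zeta^{n_3-n_1}=1$ or $\zeta^{n_3-1}=1$. (If $\Bbbk=\mathbb R$, this concerns only $\zeta=-1$, and only when at least one of $n_3-n_2$, $n_3-n_1$, $n_3-1$ is even.) Let $\mathcal S$ be the number of nonconstant solutions $x\in\Bbbk(t)$ of $(\ast)$, and let $\Gamma_{\mathrm{sol}}$ be the set of all $\deg p$ with $p\in\Bbbk[t]$ such that $1/p$ is a nonconstant solution of $(\ast)$. For an integer $r\geq 1$ consider the alternatives - (C1) $a_1<(n_1-1)r-1$ and $a_2=(n_2-1)r-1$; - (C2) $a_1>(n_1-1)r-1$ and $a_2=a_1+(n_2-n_1)r$;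 - (C3) $a_1=(n_1-1)r-1$ and $a_2\le(n_2-1)r-1$. **Proposition.** Assume (ND) and that $(\ast)$ has at least two nonconstant rational solutions. Then $r:=\max\Gamma_{\mathrm{sol}}$ exists, exactly one of (C1), (C2), (C3) holds at $r$, and: - (a) If (C1) holds, then $T_r=\{3,2,\partial\}$ and $\mathcal S\le n_3-1$. - If (C2) holds, then $T_r=\{2,1\}$ or $T_r=\{3,2,1\}$, and - (b) if $T_r=\{2,1\}$, then $\mathcal S\le n_3$; - (c) if $T_r=\{3,2,1\}$, then $\mathcal S\le n_3-n_1$. - If (C3) holds, then $T_r$ is one of $\{2,1,\partial\}$, $\{3,1,\partial\}$, $\{3,2,1,\partial\}$, and - (d) if $T_r=\{2,1,\partial\}$, then $\mathcal S\le (n_2-1)+2(n_3-1)$; - (e) if $T_r=\{3,1,\partial\}$, then $\mathcal S\le n_3-1$; - (f) if $T_r=\{3,2,1,\partial\}$, then $\mathcal S\le n_3-1$. In particular $\mathcal S\le (n_2-1)+2(n_3-1)$ in all cases. -/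

import Mathlib

open Polynomial

noncomputable section

/-- The derivative `d/dt` on the field of rational functions `K(t)`, by the quotient rule applied
to the reduced fraction. -/
def ratDeriv {K : Type*} [Field K] (x : RatFunc K) : RatFunc K :=
  algebraMap K[X] (RatFunc K) (derivative x.num * x.denom - x.num * derivative x.denom) /
    algebraMap K[X] (RatFunc K) x.denom ^ 2

/-- The quotient rule holds for every representation of a rational function as a fraction. -/
theorem ratDeriv_div {K : Type*} [Field K] (p q : K[X]) (hq : q ≠ 0) :
    ratDeriv (algebraMap K[X] (RatFunc K) p / algebraMap K[X] (RatFunc K) q) =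
      algebraMap K[X] (RatFunc K) (derivative p * q - p * derivative q) /
        algebraMap K[X] (RatFunc K) q ^ 2 := by
  set x : RatFunc K := algebraMap K[X] (RatFunc K) p / algebraMap K[X] (RatFunc K) q with hx
  have hd : x.denom ≠ 0 := x.denom_ne_zero
  have hq' : algebraMap K[X] (RatFunc K) q ≠ 0 := RatFunc.algebraMap_ne_zero hq
  have hd' : algebraMap K[X] (RatFunc K) x.denom ≠ 0 := RatFunc.algebraMap_ne_zero hd
  have key : x.num * q = p * x.denom := (RatFunc.num_mul_eq_mul_denom_iff hq).mpr hx
  have key' := congrArg derivative key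
  simp only [derivative_mul] at key'
  rw [ratDeriv, div_eq_div_iff (pow_ne_zero 2 hd') (pow_ne_zero 2 hq')]
  simp only [← map_pow, ← map_mul]
  congr 1
  linear_combination (q * x.denom) * key' - (x.denom * derivative q + q * derivative x.denom) * key

/-- The three-term generalized Abel equation
`x' = A₃(t) x ^ n₃ + A₂(t) x ^ n₂ + A₁(t) x ^ n₁` with `1 < n₁ < n₂ < n₃` and nonzero polynomial
coefficients. -/
structure AbelEq (K : Type*) [Field K] where
  n₁ : ℕ
  n₂ : ℕ
  n₃ : ℕ
  one_lt_n₁ : 1 < n₁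
  n₁_lt_n₂ : n₁ < n₂
  n₂_lt_n₃ : n₂ < n₃
  A₁ : K[X]
  A₂ : K[X]
  A₃ : K[X]
  A₁_ne_zero : A₁ ≠ 0
  A₂_ne_zero : A₂ ≠ 0
  A₃_ne_zero : A₃ ≠ 0

/-- The four indices `3, 2, 1, ∂` (`vd` stands for `∂`, the vertex of the derivative term). -/
inductive Vertex where
  | v3 | v2 | v1 | vd
  deriving DecidableEq

instance : Fintype Vertex where
  elems := {.v3, .v2, .v1, .vd}
  complete := fun l => by cases l <;> decide

namespace AbelEq

variable {K : Type*} [Field K]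

/-- `x ∈ K(t)` is a solution of the equation. -/
def IsSolution (E : AbelEq K) (x : RatFunc K) : Prop :=
  ratDeriv x = algebraMap K[X] (RatFunc K) E.A₃ * x ^ E.n₃ +
    algebraMap K[X] (RatFunc K) E.A₂ * x ^ E.n₂ + algebraMap K[X] (RatFunc K) E.A₁ * x ^ E.n₁

/-- The set of nonconstant rational solutions. -/
def solutions (E : AbelEq K) : Set (RatFunc K) :=
  {x | E.IsSolution x ∧ ∀ c : K, x ≠ RatFunc.C c}

/-- The number `𝒮` of nonconstant rational solutions (`⊤` if there were infinitely many). -/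
def S (E : AbelEq K) : ℕ∞ := E.solutions.encard

/-- The set of realized denominator degrees: all `deg p` such that `1 / p` is a
nonconstant rational solution. -/
def GammaSol (E : AbelEq K) : Set ℕ :=
  {d | ∃ p : K[X], 1 / algebraMap K[X] (RatFunc K) p ∈ E.solutions ∧ p.natDegree = d}

/-- The degrees `a₁, a₂, a₃` of the coefficients. -/
def a₁ (E : AbelEq K) : ℕ := E.A₁.natDegree

/-- See `a₁`. -/
def a₂ (E : AbelEq K) : ℕ := E.A₂.natDegree

/-- See `a₁`. -/
def a₃ (E : AbelEq K) : ℕ := E.A₃.natDegree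

/-- The order functions `Φ_i(r) = n_i r - a_i` and `Φ_∂(r) = r + 1`. -/
def Phi (E : AbelEq K) (r : ℕ) : Vertex → ℤ
  | .v3 => E.n₃ * r - E.a₃
  | .v2 => E.n₂ * r - E.a₂
  | .v1 => E.n₁ * r - E.a₁
  | .vd => r + 1

/-- The tie set `T_r`: the indices at which `Φ_ℓ(r)` attains its minimum `O_r`. -/
def T (E : AbelEq K) (r : ℕ) : Finset Vertex :=
  Finset.univ.filter fun l => ∀ k, E.Phi r l ≤ E.Phi r k

/-- `r > 0` is edge-admissible if at least two of the orders tie at the minimum. -/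
def EdgeAdmissible (E : AbelEq K) (r : ℕ) : Prop := 0 < r ∧ 2 ≤ (E.T r).card

/-- The monomials of the edge polynomials: `α_i C ^ n_i` (with `α_i` the leading coefficient of
`A_i`) for `i = 3, 2, 1`, and `r C` for `∂`. -/
def edgeTerm (E : AbelEq K) (r : ℕ) : Vertex → K[X]
  | .v3 => C E.A₃.leadingCoeff * X ^ E.n₃
  | .v2 => C E.A₂.leadingCoeff * X ^ E.n₂
  | .v1 => C E.A₁.leadingCoeff * X ^ E.n₁
  | .vd => C (r : K) * X

/-- The edge polynomial `P_r`. -/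
def P (E : AbelEq K) (r : ℕ) : K[X] := ∑ l ∈ E.T r, E.edgeTerm r l

/-- The reduced edge polynomial `P_r(C) / C ^ e_r`, with `e_r` the multiplicity of `0` as a root
of `P_r` (the division is exact). -/
def Ptilde (E : AbelEq K) (r : ℕ) : K[X] := E.P r / X ^ (E.P r).rootMultiplicity 0

/-- The set `Γ` of candidate denominator degrees: the positive integers `r ≤ r₀` among
`r₃₂, r₃₁, r₂₁, r₃∂, r₂∂, r₁∂`. -/
def Gamma (E : AbelEq K) : Set ℕ :=
  {r | 0 < r ∧ (r : ℚ) ≤ E.a₃ / (E.n₃ - E.n₂) ∧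
    ((r : ℚ) = (E.a₃ - E.a₂) / (E.n₃ - E.n₂) ∨ (r : ℚ) = (E.a₃ - E.a₁) / (E.n₃ - E.n₁) ∨
      (r : ℚ) = (E.a₂ - E.a₁) / (E.n₂ - E.n₁) ∨ (r : ℚ) = (E.a₃ + 1) / (E.n₃ - 1) ∨
      (r : ℚ) = (E.a₂ + 1) / (E.n₂ - 1) ∨ (r : ℚ) = (E.a₁ + 1) / (E.n₁ - 1))}

/-- First nondegeneracy condition at `r`: the reduced edge polynomial has only simple roots. -/
def ND1 (E : AbelEq K) (r : ℕ) : Prop :=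
  resultant (E.Ptilde r) (derivative (E.Ptilde r)) ≠ 0

/-- Second nondegeneracy condition at `r`: if `∂ ∈ T_r`, then `P_r'(C)` is not a negative integer
for any nonzero root `C ∈ K` of `P_r`. -/
def ND2 (E : AbelEq K) (r : ℕ) : Prop :=
  Vertex.vd ∈ E.T r → ∀ c : K, c ≠ 0 → (E.P r).eval c = 0 →
    ∀ m : ℤ, m < 0 → (derivative (E.P r)).eval c ≠ (m : K)

/-- Third nondegeneracy condition at `r`: separation of the roots of the reduced edge polynomial
under the roots of unity `ζ ≠ 1` of `K` of order dividing `n₃ - n₂`, `n₃ - n₁` or `n₃ - 1`.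
For `K = ℝ` the only possible `ζ` is `-1`, and it occurs exactly when one of these three integers
is even; the condition then reads `Res (P̃_r(C), P̃_r(-C)) ≠ 0`. -/
def ND3 (E : AbelEq K) (r : ℕ) : Prop :=
  ∀ ζ : K, (ζ ^ (E.n₃ - E.n₂) = 1 ∨ ζ ^ (E.n₃ - E.n₁) = 1 ∨ ζ ^ (E.n₃ - 1) = 1) → ζ ≠ 1 →
    resultant (E.Ptilde r) ((E.Ptilde r).comp (C ζ⁻¹ * X)) ≠ 0

/-- The nondegeneracy hypothesis. -/
def ND (E : AbelEq K) : Prop :=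
  ∀ r ∈ E.Gamma, E.EdgeAdmissible r → E.ND1 r ∧ E.ND2 r ∧ E.ND3 r

/-- Alternative (C1) at degree `d`. -/
def C1 (E : AbelEq K) (d : ℕ) : Prop :=
  (E.a₁ : ℤ) < (E.n₁ - 1) * d - 1 ∧ (E.a₂ : ℤ) = (E.n₂ - 1) * d - 1

/-- Alternative (C2) at degree `d`. -/
def C2 (E : AbelEq K) (d : ℕ) : Prop :=
  (E.a₁ : ℤ) > (E.n₁ - 1) * d - 1 ∧ (E.a₂ : ℤ) = E.a₁ + (E.n₂ - E.n₁) * d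

/-- Alternative (C3) at degree `d`. -/
def C3 (E : AbelEq K) (d : ℕ) : Prop :=
  (E.a₁ : ℤ) = (E.n₁ - 1) * d - 1 ∧ (E.a₂ : ℤ) ≤ (E.n₂ - 1) * d - 1

end AbelEq

end

/-!
A rational solution has constant numerator `f`: after clearing denominators, `f ^ 2` divides
`f' d - f d'`, so `f ∣ f'`. The nonconstant solutions are therefore the `1 / p` with `p` a
nonconstant polynomial such that
`A₃ + A₂ p ^ (n₃ - n₂) + A₁ p ^ (n₃ - n₁) + p ^ (n₃ - 2) p' = 0` (`solutions_eq_image`). Since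
`p ^ (n₃ - n₂)` divides `A₃`, the degrees of such `p` are bounded, and comparing the top coefficients
of the four summands shows that `P_r(1/c) = 0`, where `r` is the degree and `c` the leading
coefficient of `p` (`eval_P_inv_leadingCoeff`). In particular `r` is edge-admissible and lies in `Γ`,
so that the nondegeneracy hypothesis applies at `r`.

Linearizing the identity at `p` shows that `p` is determined by `r` and `c`
(`eq_of_leadingCoeff_eq`): a second such polynomial would differ from `p` in some degree `m < r`,
and the first difference could only vanish at the top if `P_r'(1/c)` were `0` (when `∂ ∉ T_r`) or
the negative integer `m - r` (when `∂ ∈ T_r`). Hence the number of denominators of degree `r` is at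
most the number of nonzero roots of `P_r`.

Subtracting the identities of two different denominators eliminates `A₃`. With `r` the larger of
the two degrees, the separation of the roots of `P_r` under roots of unity prevents any cancellation
between corresponding top terms, so the maximal formal degree among the terms `2, 1, ∂` is attained
twice (`degree_ties`); this is the trichotomy (C1), (C2), (C3). The ties `{2, ∂}` and `{1, ∂}` are
impossible, because then `P_r` is a binomial with `P_r'(1/c) = -(n_i - 1) r`.

Finally let `r` be the maximal degree. If `3 ∈ T_r`, then at a smaller degree the term `A₃` could
not be cancelled, and all denominators have degree `r`. Otherwise `T_r` contains `2` and `1`, and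
at a smaller degree `s` the term `2` dominates `1` and `∂`, so that `T_s = {3, 2}`; this
determines `s` and leaves at most `n₃ - n₂` denominators of degree `s`.
-/

namespace AbelEq

variable {K : Type*} [Field K]

/-! ### Rational solutions are reciprocals of polynomials -/

/-- The polynomials `p` for which `1 / p` is a nonconstant rational solution, described by the
polynomial identity that the equation becomes after multiplication by `p ^ n₃`. -/
def denominators (E : AbelEq K) : Set K[X] :=
  {p | 0 < p.natDegree ∧ E.A₃ + E.A₂ * p ^ (E.n₃ - E.n₂) + E.A₁ * p ^ (E.n₃ - E.n₁) +
    p ^ (E.n₃ - 2) * derivative p = 0}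

theorem isSolution_one_div_iff (E : AbelEq K) {p : K[X]} (hp : p ≠ 0) :
    E.IsSolution (1 / algebraMap K[X] (RatFunc K) p) ↔
      E.A₃ + E.A₂ * p ^ (E.n₃ - E.n₂) + E.A₁ * p ^ (E.n₃ - E.n₁) +
        p ^ (E.n₃ - 2) * derivative p = 0 := by
  have h1 := E.one_lt_n₁
  have h12 := E.n₁_lt_n₂
  have h23 := E.n₂_lt_n₃
  have hP : algebraMap K[X] (RatFunc K) p ≠ 0 := RatFunc.algebraMap_ne_zero hp
  have hd := ratDeriv_div (1 : K[X]) p hp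
  rw [map_one] at hd
  rw [IsSolution, hd, ← (FaithfulSMul.algebraMap_injective K[X] (RatFunc K)).eq_iff]
  obtain ⟨k₂, hk₂⟩ := Nat.exists_eq_add_of_le h23.le
  obtain ⟨k₁, hk₁⟩ := Nat.exists_eq_add_of_le (h12.trans h23).le
  obtain ⟨k, hk⟩ := Nat.exists_eq_add_of_le (show 2 ≤ E.n₃ by omega)
  rw [show E.n₃ - E.n₂ = k₂ by omega, show E.n₃ - E.n₁ = k₁ by omega,
    show E.n₃ - 2 = k by omega]
  simp only [derivative_one, zero_mul, zero_sub, one_mul, map_neg, map_add, map_mul, map_pow,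
    map_zero, one_div, inv_pow]
  have hP₃ := pow_ne_zero E.n₃ hP
  have e₂ : (algebraMap K[X] (RatFunc K) p ^ E.n₂)⁻¹ =
      algebraMap K[X] (RatFunc K) p ^ k₂ * (algebraMap K[X] (RatFunc K) p ^ E.n₃)⁻¹ := by
    rw [hk₂, pow_add]; field_simp
  have e₁ : (algebraMap K[X] (RatFunc K) p ^ E.n₁)⁻¹ =
      algebraMap K[X] (RatFunc K) p ^ k₁ * (algebraMap K[X] (RatFunc K) p ^ E.n₃)⁻¹ := by
    rw [hk₁, pow_add]; field_simp
  have e : (algebraMap K[X] (RatFunc K) p ^ 2)⁻¹ =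
      algebraMap K[X] (RatFunc K) p ^ k * (algebraMap K[X] (RatFunc K) p ^ E.n₃)⁻¹ := by
    rw [hk, pow_add]; field_simp
  rw [e₂, e₁, div_eq_mul_inv, e]
  generalize (algebraMap K[X] (RatFunc K) p ^ E.n₃) = Q at *
  constructor
  · intro h
    have h' := congrArg (· * Q) h
    field_simp at h'
    linear_combination -h'
  · intro h
    linear_combination -Q⁻¹ * h

theorem one_div_ne_C {p : K[X]} (hp : 0 < p.natDegree) (c : K) :
    1 / algebraMap K[X] (RatFunc K) p ≠ RatFunc.C c := by
  have hp0 : p ≠ 0 := fun h => by simp [h] at hp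
  intro h
  rw [div_eq_iff (RatFunc.algebraMap_ne_zero hp0), ← RatFunc.algebraMap_C, ← map_mul,
    ← map_one (algebraMap K[X] (RatFunc K)),
    (FaithfulSMul.algebraMap_injective K[X] (RatFunc K)).eq_iff] at h
  have hu : IsUnit p := IsUnit.of_mul_eq_one (C c) (by rw [mul_comm, ← h])
  exact hp.ne' (natDegree_eq_zero_of_isUnit hu)

theorem one_div_mem_solutions_iff (E : AbelEq K) {p : K[X]} :
    1 / algebraMap K[X] (RatFunc K) p ∈ E.solutions ↔ p ∈ E.denominators := by
  constructor
  · rintro ⟨hs, hc⟩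
    have hdeg : 0 < p.natDegree := by
      by_contra h0
      obtain ⟨a, ha⟩ := natDegree_eq_zero.mp (Nat.eq_zero_of_not_pos h0)
      refine hc a⁻¹ ?_
      rw [← ha, RatFunc.algebraMap_C, map_inv₀, one_div]
    have hp0 : p ≠ 0 := fun h => by simp [h] at hdeg
    exact ⟨hdeg, (E.isSolution_one_div_iff hp0).mp hs⟩
  · rintro ⟨hdeg, h⟩
    have hp0 : p ≠ 0 := fun h => by simp [h] at hdeg
    exact ⟨(E.isSolution_one_div_iff hp0).mpr h, one_div_ne_C hdeg⟩

/-- The numerator `f` of a rational solution is constant: clearing denominators shows that `f ^ 2`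
divides `f' d - f d'`, hence that `f` divides `f'`. -/
theorem natDegree_num_eq_zero [CharZero K] (E : AbelEq K) {x : RatFunc K}
    (hx : E.IsSolution x) : x.num.natDegree = 0 := by
  have h1 := E.one_lt_n₁
  have h12 := E.n₁_lt_n₂
  have h23 := E.n₂_lt_n₃
  set f := x.num with hf
  set d := x.denom with hd
  have hcop : IsCoprime f d := x.isCoprime_num_denom
  have hD : algebraMap K[X] (RatFunc K) d ≠ 0 := RatFunc.algebraMap_ne_zero x.denom_ne_zero
  obtain ⟨k₂, hk₂⟩ := Nat.exists_eq_add_of_le h23.le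
  obtain ⟨k₁, hk₁⟩ := Nat.exists_eq_add_of_le (h12.trans h23).le
  obtain ⟨k, hk⟩ := Nat.exists_eq_add_of_le (show 2 ≤ E.n₃ by omega)
  have key : d ^ k * (derivative f * d - f * derivative d) =
      E.A₃ * f ^ E.n₃ + E.A₂ * f ^ E.n₂ * d ^ k₂ + E.A₁ * f ^ E.n₁ * d ^ k₁ := by
    apply FaithfulSMul.algebraMap_injective K[X] (RatFunc K)
    have h := hx
    rw [IsSolution, ratDeriv, ← hf, ← hd] at h
    have hxe : x = algebraMap K[X] (RatFunc K) f / algebraMap K[X] (RatFunc K) d :=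
      x.num_div_denom.symm
    rw [hxe] at h
    simp only [div_pow] at h
    have e₂ : (algebraMap K[X] (RatFunc K) d ^ E.n₂) *
      algebraMap K[X] (RatFunc K) d ^ k₂ = algebraMap K[X] (RatFunc K) d ^ E.n₃ := by
      rw [hk₂, pow_add]
    have e₁ : (algebraMap K[X] (RatFunc K) d ^ E.n₁) *
      algebraMap K[X] (RatFunc K) d ^ k₁ = algebraMap K[X] (RatFunc K) d ^ E.n₃ := by
      rw [hk₁, pow_add]
    have e : (algebraMap K[X] (RatFunc K) d ^ 2) *
      algebraMap K[X] (RatFunc K) d ^ k = algebraMap K[X] (RatFunc K) d ^ E.n₃ := by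
      rw [hk, pow_add]
    have h' := congrArg (· * algebraMap K[X] (RatFunc K) d ^ E.n₃) h
    simp only [add_mul] at h'
    have hA : ∀ (a b : RatFunc K) (m l : ℕ), algebraMap K[X] (RatFunc K) d ^ m *
        algebraMap K[X] (RatFunc K) d ^ l = algebraMap K[X] (RatFunc K) d ^ E.n₃ →
        a * (b / algebraMap K[X] (RatFunc K) d ^ m) * algebraMap K[X] (RatFunc K) d ^ E.n₃ =
          a * b * algebraMap K[X] (RatFunc K) d ^ l := by
      intro a b m l hml
      rw [← hml]; field_simp
    have hl := hA 1 (algebraMap K[X] (RatFunc K) (derivative f * d - f * derivative d)) 2 k e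
    rw [one_mul] at hl
    rw [hl, hA _ _ _ _ e₁, hA _ _ _ _ e₂, hA _ _ E.n₃ 0 (by simp)] at h'
    simp only [map_add, map_mul, map_pow]
    rw [pow_zero, mul_one, one_mul] at h'
    rw [← h', mul_comm]
  have hdvd : f ^ 2 ∣ d ^ k * (derivative f * d - f * derivative d) := by
    rw [key]
    have hm : ∀ m, 2 ≤ m → ∀ a b : K[X], f ^ 2 ∣ a * f ^ m * b := fun m hm a b =>
      ((pow_dvd_pow f hm).mul_left a).mul_right b
    refine dvd_add (dvd_add ?_ (hm _ (by omega) _ _)) (hm _ (by omega) _ _)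
    exact (pow_dvd_pow f (by omega)).mul_left _
  have hdvd₂ : f ∣ derivative f * d - f * derivative d :=
    (dvd_pow_self f two_ne_zero).trans (hcop.pow.dvd_of_dvd_mul_left hdvd)
  have hdvd₃ : f ∣ derivative f :=
    hcop.dvd_of_dvd_mul_right ((dvd_sub_left (dvd_mul_right f (derivative d))).mp hdvd₂)
  by_contra hne
  have h0 : derivative f ≠ 0 := fun h0 => hne (derivative_eq_zero.mp h0)
  exact absurd (natDegree_le_of_dvd hdvd₃ h0) (not_le.mpr (natDegree_derivative_lt hne))

theorem solutions_eq_image [CharZero K] (E : AbelEq K) :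
    E.solutions = (fun p => 1 / algebraMap K[X] (RatFunc K) p) '' E.denominators := by
  ext x
  constructor
  · intro hx
    obtain ⟨a, ha⟩ := natDegree_eq_zero.mp (E.natDegree_num_eq_zero hx.1)
    have ha0 : a ≠ 0 := by
      rintro rfl
      rw [C_0] at ha
      exact hx.2 0 (by rw [map_zero, ← RatFunc.num_eq_zero_iff, ← ha])
    have hxe : x = 1 / algebraMap K[X] (RatFunc K) (C a⁻¹ * x.denom) := by
      conv_lhs => rw [← x.num_div_denom, ← ha]
      rw [map_mul, RatFunc.algebraMap_C, RatFunc.algebraMap_C, map_inv₀, one_div, mul_inv, inv_inv,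
        div_eq_mul_inv]
    refine ⟨C a⁻¹ * x.denom, ?_, hxe.symm⟩
    rw [← one_div_mem_solutions_iff, ← hxe]
    exact hx
  · rintro ⟨p, hp, rfl⟩
    exact E.one_div_mem_solutions_iff.mpr hp

theorem S_eq_encard_denominators [CharZero K] (E : AbelEq K) : E.S = E.denominators.encard := by
  rw [S, solutions_eq_image]
  refine Function.Injective.encard_image (fun p q h => ?_) _
  simp only [one_div, inv_inj] at h
  exact FaithfulSMul.algebraMap_injective K[X] (RatFunc K) h

theorem gammaSol_eq_image (E : AbelEq K) : E.GammaSol = natDegree '' E.denominators := by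
  ext d
  simp only [GammaSol, one_div_mem_solutions_iff, Set.mem_ofPred_eq, Set.mem_image]

/-! ### Top coefficients of the polynomial identity -/

theorem univ_vertex : (Finset.univ : Finset Vertex) = {.v3, .v2, .v1, .vd} := rfl

theorem P_eq_sum_ite (E : AbelEq K) (r : ℕ) :
    E.P r = (if Vertex.v3 ∈ E.T r then C E.A₃.leadingCoeff * X ^ E.n₃ else 0) +
      (if Vertex.v2 ∈ E.T r then C E.A₂.leadingCoeff * X ^ E.n₂ else 0) +
      (if Vertex.v1 ∈ E.T r then C E.A₁.leadingCoeff * X ^ E.n₁ else 0) +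
      (if Vertex.vd ∈ E.T r then C (r : K) * X else 0) := by
  have h : E.P r = ∑ l, if l ∈ E.T r then E.edgeTerm r l else 0 := by
    rw [P, Finset.sum_ite_mem, Finset.univ_inter]
  rw [h, univ_vertex]
  rw [Finset.sum_insert (by decide), Finset.sum_insert (by decide), Finset.sum_insert (by decide),
    Finset.sum_singleton]
  simp only [edgeTerm]
  ring

/-- For `p` of degree `r`, the summands of the polynomial identity have formal degrees
`n₃ r - Φ_ℓ(r)`. `IsTopDegree E r D` says that `D` is the largest of these; the numbers are
compared in a form free of subtraction of degrees. -/
structure IsTopDegree (E : AbelEq K) (r D : ℕ) : Prop where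
  le₃ : E.a₃ ≤ D
  le₂ : E.a₂ + (E.n₃ - E.n₂) * r ≤ D
  le₁ : E.a₁ + (E.n₃ - E.n₁) * r ≤ D
  led : (E.n₃ - 1) * r ≤ D + 1
  mem₃ : Vertex.v3 ∈ E.T r ↔ E.a₃ = D
  mem₂ : Vertex.v2 ∈ E.T r ↔ E.a₂ + (E.n₃ - E.n₂) * r = D
  mem₁ : Vertex.v1 ∈ E.T r ↔ E.a₁ + (E.n₃ - E.n₁) * r = D
  memd : Vertex.vd ∈ E.T r ↔ (E.n₃ - 1) * r = D + 1

theorem T_nonempty (E : AbelEq K) (r : ℕ) : (E.T r).Nonempty := by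
  obtain ⟨l, -, hl⟩ := Finset.exists_min_image Finset.univ (E.Phi r) ⟨.v3, Finset.mem_univ _⟩
  exact ⟨l, by simpa [T] using fun k => hl k (Finset.mem_univ k)⟩

theorem exists_isTopDegree (E : AbelEq K) {r : ℕ} (hr : 0 < r) : ∃ D, E.IsTopDegree r D := by
  have h1 := E.one_lt_n₁
  have h12 := E.n₁_lt_n₂
  have h23 := E.n₂_lt_n₃
  obtain ⟨l, hl⟩ := E.T_nonempty r
  simp only [T, Finset.mem_filter, Finset.mem_univ, true_and] at hl
  have hmem : ∀ k, k ∈ E.T r ↔ E.Phi r k = E.Phi r l := by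
    intro k
    simp only [T, Finset.mem_filter, Finset.mem_univ, true_and]
    exact ⟨fun h => le_antisymm (h l) (hl k), fun h j => h.trans_le (hl j)⟩
  have e₂ : (E.n₃ : ℤ) * r = E.n₂ * r + ((E.n₃ - E.n₂) * r : ℕ) := by
    push_cast [Nat.cast_sub h23.le]; ring
  have e₁ : (E.n₃ : ℤ) * r = E.n₁ * r + ((E.n₃ - E.n₁) * r : ℕ) := by
    push_cast [Nat.cast_sub (h12.trans h23).le]; ring
  have e : (E.n₃ : ℤ) * r = r + ((E.n₃ - 1) * r : ℕ) := by
    push_cast [Nat.cast_sub (show 1 ≤ E.n₃ by omega)]; ring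
  have hpos : 0 < (E.n₃ - 1) * r := Nat.mul_pos (by omega) hr
  have i₃ := hl .v3
  have i₂ := hl .v2
  have i₁ := hl .v1
  have i := hl .vd
  have m₃ := hmem .v3
  have m₂ := hmem .v2
  have m₁ := hmem .v1
  have m := hmem .vd
  clear hl hmem
  generalize E.Phi r l = φ at i₃ i₂ i₁ i m₃ m₂ m₁ m
  simp only [Phi] at i₃ i₂ i₁ i m₃ m₂ m₁ m
  refine ⟨((E.n₃ : ℤ) * r - φ).toNat, ⟨?_, ?_, ?_, ?_, ?_, ?_, ?_, ?_⟩⟩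
  · omega
  · omega
  · omega
  · omega
  · rw [m₃]; omega
  · rw [m₂]; omega
  · rw [m₁]; omega
  · rw [m]; omega

theorem coeff_eq_ite {f : K[X]} {m : ℕ} (h : f.natDegree ≤ m) :
    f.coeff m = if f.natDegree = m then f.leadingCoeff else 0 := by
  split_ifs with h'
  · rw [← h', coeff_natDegree]
  · exact coeff_eq_zero_of_natDegree_lt (lt_of_le_of_ne h h')

/-- The coefficient of `C` in the edge polynomial when `D` is the top degree: `r` if `∂` ties at
the top, which means that `p ^ (n₃ - 2) p'` has formal degree `(n₃ - 1) r - 1 = D`, and `0`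
otherwise. -/
def derivTie (E : AbelEq K) (r D : ℕ) : K := if (E.n₃ - 1) * r = D + 1 then r else 0

theorem IsTopDegree.P_eq {E : AbelEq K} {r D : ℕ} (hD : E.IsTopDegree r D) :
    E.P r = C (E.A₃.coeff D) * X ^ E.n₃ + C (E.A₂.coeff (D - (E.n₃ - E.n₂) * r)) * X ^ E.n₂ +
      C (E.A₁.coeff (D - (E.n₃ - E.n₁) * r)) * X ^ E.n₁ + C (E.derivTie r D) * X := by
  have h₃ := hD.le₃
  have h₂ := hD.le₂
  have h₁ := hD.le₁
  rw [P_eq_sum_ite, coeff_eq_ite hD.le₃,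
    coeff_eq_ite (show E.A₂.natDegree ≤ D - (E.n₃ - E.n₂) * r by rw [a₂] at h₂; omega),
    coeff_eq_ite (show E.A₁.natDegree ≤ D - (E.n₃ - E.n₁) * r by rw [a₁] at h₁; omega), derivTie]
  have m₂ : Vertex.v2 ∈ E.T r ↔ E.A₂.natDegree = D - (E.n₃ - E.n₂) * r := by
    rw [hD.mem₂, ← a₂]; omega
  have m₁ : Vertex.v1 ∈ E.T r ↔ E.A₁.natDegree = D - (E.n₃ - E.n₁) * r := by
    rw [hD.mem₁, ← a₁]; omega
  simp only [hD.mem₃, m₂, m₁, hD.memd, a₃]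
  split_ifs <;> simp

theorem coeff_mul_pow_eq {A p : K[X]} {r D k : ℕ} (hp : p.natDegree ≤ r)
    (hA : A.natDegree + k * r ≤ D) :
    (A * p ^ k).coeff D = A.coeff (D - k * r) * p.coeff r ^ k := by
  have := coeff_mul_add_eq_of_natDegree_le (f := A) (g := p ^ k) (df := D - k * r) (dg := k * r)
    (by omega) (natDegree_pow_le_of_le k hp)
  rwa [Nat.sub_add_cancel (by omega), coeff_pow_of_natDegree_le hp] at this

theorem coeff_pow_mul_derivative [CharZero K] (E : AbelEq K) {p : K[X]} {r D : ℕ}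
    (hp : p.natDegree ≤ r) (hr : (E.n₃ - 1) * r ≤ D + 1) :
    (p ^ (E.n₃ - 2) * derivative p).coeff D = E.derivTie r D * p.coeff r ^ (E.n₃ - 1) := by
  have h1 := E.one_lt_n₁
  have h12 := E.n₁_lt_n₂
  have h23 := E.n₂_lt_n₃
  -- `(n₃ - 1) p ^ (n₃ - 2) p'` is the derivative of `p ^ (n₃ - 1)`.
  have hn : ((E.n₃ - 1 : ℕ) : K) ≠ 0 := Nat.cast_ne_zero.mpr (by omega)
  have h := congrArg (fun f => coeff f D) (derivative_pow p (E.n₃ - 1))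
  simp only [coeff_derivative] at h
  rw [coeff_pow_eq_ite_of_natDegree_le_of_le hp hr, mul_assoc, coeff_C_mul,
    show E.n₃ - 1 - 1 = E.n₃ - 2 by omega] at h
  apply mul_left_cancel₀ hn
  rw [← h, derivTie]
  by_cases hc : (E.n₃ - 1) * r = D + 1
  · rw [if_pos hc.symm, if_pos hc, ← Nat.cast_succ, Nat.succ_eq_add_one, ← hc]
    push_cast; ring
  · rw [if_neg (Ne.symm hc), if_neg hc]; ring

/-- The right-hand side is the coefficient at the top degree `D` of the polynomial identity, as a
function of the leading coefficient `c`. -/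
theorem IsTopDegree.eval_P_inv_mul {E : AbelEq K} {r D : ℕ} (hD : E.IsTopDegree r D) {c : K}
    (hc : c ≠ 0) : (E.P r).eval c⁻¹ * c ^ E.n₃ = E.A₃.coeff D +
      E.A₂.coeff (D - (E.n₃ - E.n₂) * r) * c ^ (E.n₃ - E.n₂) +
      E.A₁.coeff (D - (E.n₃ - E.n₁) * r) * c ^ (E.n₃ - E.n₁) +
      E.derivTie r D * c ^ (E.n₃ - 1) := by
  have h1 := E.one_lt_n₁
  have h12 := E.n₁_lt_n₂
  have h23 := E.n₂_lt_n₃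
  rw [hD.P_eq]
  simp only [eval_add, eval_mul, eval_C, eval_pow, eval_X]
  rw [pow_sub₀ c hc h23.le, pow_sub₀ c hc (h12.trans h23).le,
    pow_sub₀ c hc (show 1 ≤ E.n₃ by omega)]
  simp only [inv_pow, pow_one]
  field_simp

theorem eval_P_inv_leadingCoeff [CharZero K] {E : AbelEq K} {p : K[X]} (hp : p ∈ E.denominators) :
    (E.P p.natDegree).eval p.leadingCoeff⁻¹ = 0 := by
  obtain ⟨hr, heq⟩ := hp
  have hc : p.leadingCoeff ≠ 0 := leadingCoeff_ne_zero.mpr fun h => by simp [h] at hr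
  obtain ⟨D, hD⟩ := E.exists_isTopDegree hr
  have h := congrArg (fun f => coeff f D) heq
  simp only [coeff_add, coeff_zero] at h
  rw [coeff_mul_pow_eq le_rfl hD.le₂, coeff_mul_pow_eq le_rfl hD.le₁,
    E.coeff_pow_mul_derivative le_rfl hD.led, coeff_natDegree, ← hD.eval_P_inv_mul hc] at h
  exact (mul_eq_zero.mp h).resolve_right (pow_ne_zero _ hc)

theorem eval_edgeTerm_ne_zero [CharZero K] (E : AbelEq K) {r : ℕ} (hr : 0 < r) {x : K}
    (hx : x ≠ 0) (l : Vertex) : (E.edgeTerm r l).eval x ≠ 0 := by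
  cases l <;> simp [edgeTerm, hx, hr.ne', E.A₁_ne_zero, E.A₂_ne_zero, E.A₃_ne_zero]

theorem edgeAdmissible_of_mem_denominators [CharZero K] {E : AbelEq K} {p : K[X]}
    (hp : p ∈ E.denominators) : E.EdgeAdmissible p.natDegree := by
  have hr := hp.1
  have hc : p.leadingCoeff ≠ 0 := leadingCoeff_ne_zero.mpr fun h => by simp [h] at hr
  refine ⟨hr, ?_⟩
  by_contra hlt
  have hone : (E.T p.natDegree).card = 1 := by
    have := Finset.card_pos.mpr (E.T_nonempty p.natDegree)
    omega
  obtain ⟨k, hk⟩ := Finset.card_eq_one.mp hone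
  have h0 := eval_P_inv_leadingCoeff hp
  rw [P, hk, Finset.sum_singleton] at h0
  exact E.eval_edgeTerm_ne_zero hr (inv_ne_zero hc) k h0

/-- The bound holds because `p ^ (n₃ - n₂)` divides `A₃`. -/
theorem mul_natDegree_le {E : AbelEq K} {p : K[X]} (hp : p ∈ E.denominators) :
    (E.n₃ - E.n₂) * p.natDegree ≤ E.a₃ := by
  have h1 := E.one_lt_n₁
  have h12 := E.n₁_lt_n₂
  have h23 := E.n₂_lt_n₃
  have hdvd : p ^ (E.n₃ - E.n₂) ∣ E.A₃ := by
    have h : E.A₃ = -(E.A₂ * p ^ (E.n₃ - E.n₂) + E.A₁ * p ^ (E.n₃ - E.n₁) +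
      p ^ (E.n₃ - 2) * derivative p) := by linear_combination hp.2
    rw [h, dvd_neg]
    exact dvd_add (dvd_add (dvd_mul_left _ _)
      ((pow_dvd_pow p (by omega)).mul_left _)) ((pow_dvd_pow p (by omega)).mul_right _)
  simpa [a₃, natDegree_pow] using natDegree_le_of_dvd hdvd E.A₃_ne_zero

theorem natDegree_mem_Gamma [CharZero K] {E : AbelEq K} {p : K[X]} (hp : p ∈ E.denominators) :
    p.natDegree ∈ E.Gamma := by
  have h1 := E.one_lt_n₁
  have h12 := E.n₁_lt_n₂
  have h23 := E.n₂_lt_n₃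
  have hcard := (edgeAdmissible_of_mem_denominators hp).2
  have hle := mul_natDegree_le hp
  have q1 : (1 : ℚ) < E.n₁ := by exact_mod_cast h1
  have q12 : (E.n₁ : ℚ) < E.n₂ := by exact_mod_cast h12
  have q23 : (E.n₂ : ℚ) < E.n₃ := by exact_mod_cast h23
  refine ⟨hp.1, ?_, ?_⟩
  · rw [le_div_iff₀ (by linarith), mul_comm, ← Nat.cast_sub h23.le]
    exact_mod_cast hle
  obtain ⟨l, hl, k, hk, hlk⟩ := Finset.one_lt_card.mp hcard
  have heq : E.Phi p.natDegree l = E.Phi p.natDegree k := by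
    simp only [T, Finset.mem_filter, Finset.mem_univ, true_and] at hl hk
    exact le_antisymm (hl k) (hk l)
  have heq' : (E.Phi p.natDegree l : ℚ) = E.Phi p.natDegree k := by rw [heq]
  rw [eq_div_iff (by linarith), eq_div_iff (by linarith), eq_div_iff (by linarith),
    eq_div_iff (by linarith), eq_div_iff (by linarith), eq_div_iff (by linarith)]
  cases l <;> cases k <;> first
    | exact absurd rfl hlk
    | (simp only [Phi] at heq'
       push_cast at heq'
       first
        | (left; linarith)
        | (right; left; linarith)
        | (right; right; left; linarith)
        | (right; right; right; left; linarith)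
        | (right; right; right; right; left; linarith)
        | (right; right; right; right; right; linarith))

/-! ### Edge polynomials and nondegeneracy -/

/-- The exponent of `C` in the monomial that a vertex contributes to the edge polynomial. -/
def exponent (E : AbelEq K) : Vertex → ℕ
  | .v3 => E.n₃
  | .v2 => E.n₂
  | .v1 => E.n₁
  | .vd => 1

theorem exponent_injective (E : AbelEq K) : Function.Injective E.exponent := by
  have h1 := E.one_lt_n₁
  have h12 := E.n₁_lt_n₂
  have h23 := E.n₂_lt_n₃
  intro l k h
  cases l <;> cases k <;> simp only [exponent] at h <;> first | rfl | omega

theorem exists_edgeTerm_eq [CharZero K] (E : AbelEq K) {r : ℕ} (hr : 0 < r) (l : Vertex) :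
    ∃ a : K, a ≠ 0 ∧ E.edgeTerm r l = C a * X ^ E.exponent l := by
  cases l
  · exact ⟨_, leadingCoeff_ne_zero.mpr E.A₃_ne_zero, rfl⟩
  · exact ⟨_, leadingCoeff_ne_zero.mpr E.A₂_ne_zero, rfl⟩
  · exact ⟨_, leadingCoeff_ne_zero.mpr E.A₁_ne_zero, rfl⟩
  · exact ⟨r, Nat.cast_ne_zero.mpr hr.ne', by simp [edgeTerm, exponent]⟩

theorem P_ne_zero [CharZero K] (E : AbelEq K) {r : ℕ} (hr : 0 < r) : E.P r ≠ 0 := by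
  obtain ⟨l, hl⟩ := E.T_nonempty r
  choose a ha0 ha using fun k => E.exists_edgeTerm_eq hr k
  intro h
  have h' := congrArg (fun f => coeff f (E.exponent l)) h
  simp only [P, finsetSum_coeff, ha, coeff_C_mul, coeff_X_pow, coeff_zero] at h'
  rw [Finset.sum_eq_single l (fun k _ hk => by
    rw [if_neg fun he => hk (E.exponent_injective he).symm, mul_zero])
    (fun h => absurd hl h)] at h'
  simp [ha0] at h'

theorem X_pow_mul_Ptilde (E : AbelEq K) (r : ℕ) :
    X ^ (E.P r).rootMultiplicity 0 * E.Ptilde r = E.P r := by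
  have h := pow_rootMultiplicity_dvd (E.P r) 0
  rw [C_0, sub_zero] at h
  exact EuclideanDomain.mul_div_cancel' (pow_ne_zero _ X_ne_zero) h

theorem Ptilde_ne_zero [CharZero K] (E : AbelEq K) {r : ℕ} (hr : 0 < r) : E.Ptilde r ≠ 0 := by
  intro h
  have := E.X_pow_mul_Ptilde r
  rw [h, mul_zero] at this
  exact E.P_ne_zero hr this.symm

theorem eval_Ptilde_eq_zero (E : AbelEq K) {r : ℕ} {x : K} (hx : x ≠ 0)
    (h : (E.P r).eval x = 0) : (E.Ptilde r).eval x = 0 := by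
  rw [← X_pow_mul_Ptilde, eval_mul, eval_pow, eval_X] at h
  exact (mul_eq_zero.mp h).resolve_left (pow_ne_zero _ hx)

theorem resultant_eq_zero_of_eval_eq_zero {f g : K[X]} (hf : f ≠ 0) {x : K}
    (hfx : f.eval x = 0) (hgx : g.eval x = 0) : resultant f g = 0 := by
  refine resultant_eq_zero_iff.mpr ⟨.inl hf, ?_⟩
  rintro ⟨a, b, hab⟩
  simpa [hfx, hgx] using congrArg (eval x) hab

theorem ND1.eval_derivative_P_ne_zero [CharZero K] {E : AbelEq K} {r : ℕ} (h : E.ND1 r)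
    (hr : 0 < r) {x : K} (hx : x ≠ 0) (hPx : (E.P r).eval x = 0) :
    (derivative (E.P r)).eval x ≠ 0 := by
  intro h'
  have hP' := E.eval_Ptilde_eq_zero hx hPx
  rw [← X_pow_mul_Ptilde, derivative_mul, eval_add, eval_mul, eval_mul, hP', mul_zero, zero_add,
    eval_pow, eval_X] at h'
  exact h (resultant_eq_zero_of_eval_eq_zero (E.Ptilde_ne_zero hr) hP'
    ((mul_eq_zero.mp h').resolve_left (pow_ne_zero _ hx)))

theorem ND3.eq_of_pow_eq_pow [CharZero K] {E : AbelEq K} {r : ℕ} (h : E.ND3 r)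
    (hr : 0 < r) {x y : K} (hx : x ≠ 0) (hy : y ≠ 0) (hPx : (E.P r).eval x = 0)
    (hPy : (E.P r).eval y = 0) {k : ℕ} (hk : k = E.n₃ - E.n₂ ∨ k = E.n₃ - E.n₁ ∨ k = E.n₃ - 1)
    (hxy : x ^ k = y ^ k) : x = y := by
  by_contra hne
  have hζ : (x / y) ^ k = 1 := by rw [div_pow, hxy, div_self (pow_ne_zero _ hy)]
  have hζ1 : x / y ≠ 1 := fun he => hne ((div_eq_one_iff_eq hy).mp he)
  refine h (x / y) ?_ hζ1 (resultant_eq_zero_of_eval_eq_zero (E.Ptilde_ne_zero hr)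
    (E.eval_Ptilde_eq_zero hx hPx) ?_)
  · rcases hk with rfl | rfl | rfl
    exacts [.inl hζ, .inr (.inl hζ), .inr (.inr hζ)]
  · rw [eval_comp, eval_mul, eval_C, eval_X, inv_div, div_mul_cancel₀ y hx]
    exact E.eval_Ptilde_eq_zero hy hPy

/-- If `∂` ties with a single other vertex, every nonzero root `x` of `P_r = a C ^ n + r C` has
`P_r'(x) = -(n - 1) r`, against the second nondegeneracy condition. -/
theorem ND2.P_ne_binomial {E : AbelEq K} {r : ℕ} (h : E.ND2 r) (hr : 0 < r)
    (hT : Vertex.vd ∈ E.T r) {x : K} (hx : x ≠ 0) (hPx : (E.P r).eval x = 0) {n : ℕ} (hn : 1 < n)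
    (a : K) : E.P r ≠ C a * X ^ n + C (r : K) * X := by
  intro hP
  refine h hT x hx hPx (-((n - 1) * r : ℤ)) ?_ ?_
  · have : (0 : ℤ) < (n - 1) * r := mul_pos (by omega) (by omega)
    omega
  · rw [hP] at hPx ⊢
    obtain ⟨m, rfl⟩ : ∃ m, n = m + 1 := ⟨n - 1, by omega⟩
    simp only [eval_add, eval_mul, eval_C, eval_pow, eval_X, derivative_add, derivative_C_mul,
      derivative_X_pow, derivative_X, add_tsub_cancel_right, eval_one] at hPx ⊢
    have h0 : a * x ^ m + r = 0 := by
      refine (mul_eq_zero.mp (?_ : x * (a * x ^ m + r) = 0)).resolve_left hx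
      linear_combination hPx
    push_cast
    linear_combination ((m : K) + 1) * h0

/-! ### A denominator is determined by its degree and leading coefficient -/

theorem natDegree_pow_sub_pow_le {p q : K[X]} {r m : ℕ} (hp : p.natDegree ≤ r)
    (hq : q.natDegree ≤ r) (hm : (p - q).natDegree ≤ m) {k : ℕ} (hk : 0 < k) :
    (p ^ k - q ^ k).natDegree ≤ (k - 1) * r + m := by
  rw [← (Commute.all p q).geom_sum₂_mul k]
  refine natDegree_mul_le_of_le (natDegree_sum_le_of_forall_le _ _ fun i hi => ?_) hm
  have hi' : i ≤ k - 1 := by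
    have := Finset.mem_range.mp hi
    omega
  refine (natDegree_mul_le_of_le (natDegree_pow_le_of_le i hp)
    (natDegree_pow_le_of_le (k - 1 - i) hq)).trans_eq ?_
  rw [← add_mul, Nat.add_sub_cancel' hi']

/-- The top coefficient of the linearization of `p ↦ p ^ k`. -/
theorem coeff_pow_sub_pow {p q : K[X]} {r m : ℕ} (hp : p.natDegree ≤ r)
    (hq : q.natDegree ≤ r) (hm : (p - q).natDegree ≤ m) (hc : q.coeff r = p.coeff r) {k : ℕ} :
    (p ^ k - q ^ k).coeff ((k - 1) * r + m) =
      k * p.coeff r ^ (k - 1) * (p - q).coeff m := by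
  have hdeg : ∀ i ∈ Finset.range k, i * r + (k - 1 - i) * r = (k - 1) * r := by
    intro i hi
    have := Finset.mem_range.mp hi
    rw [← add_mul, Nat.add_sub_cancel' (by omega)]
  rw [← (Commute.all p q).geom_sum₂_mul k, coeff_mul_add_eq_of_natDegree_le
    (natDegree_sum_le_of_forall_le _ _ fun i hi => ?_) hm, finsetSum_coeff]
  · congr 1
    rw [← nsmul_eq_mul, ← Finset.card_range k, ← Finset.sum_const, Finset.card_range]
    refine Finset.sum_congr rfl fun i hi => ?_
    rw [← hdeg i hi, coeff_mul_add_eq_of_natDegree_le (natDegree_pow_le_of_le i hp)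
      (natDegree_pow_le_of_le (k - 1 - i) hq), coeff_pow_of_natDegree_le hp,
      coeff_pow_of_natDegree_le hq, hc, ← pow_add]
    have := Finset.mem_range.mp hi
    rw [Nat.add_sub_cancel' (by omega)]
  · rw [← hdeg i hi]
    exact natDegree_mul_le_of_le (natDegree_pow_le_of_le i hp)
      (natDegree_pow_le_of_le (k - 1 - i) hq)

theorem coeff_mul_pow_sub_pow {A p q : K[X]} {r m D k : ℕ} (hp : p.natDegree ≤ r)
    (hq : q.natDegree ≤ r) (hm : (p - q).natDegree ≤ m) (hc : q.coeff r = p.coeff r) (hk : 0 < k)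
    (hA : A.natDegree + k * r ≤ D) :
    (A * (p ^ k - q ^ k)).coeff (D - r + m) =
      A.coeff (D - k * r) * (k * p.coeff r ^ (k - 1) * (p - q).coeff m) := by
  obtain ⟨j, rfl⟩ : ∃ j, k = j + 1 := ⟨k - 1, by omega⟩
  rw [← coeff_pow_sub_pow hp hq hm hc, ← coeff_mul_add_eq_of_natDegree_le (by omega)
    (natDegree_pow_sub_pow_le hp hq hm hk)]
  congr 1
  rw [Nat.add_sub_cancel]
  rw [add_mul, one_mul] at hA ⊢
  omega

theorem coeff_pow_mul_derivative_sub [CharZero K] (E : AbelEq K) {p q : K[X]} {r m D : ℕ}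
    (hr : 0 < r) (hp : p.natDegree ≤ r) (hq : q.natDegree ≤ r) (hm : (p - q).natDegree ≤ m)
    (hc : q.coeff r = p.coeff r) (hD : (E.n₃ - 1) * r ≤ D + 1) :
    (p ^ (E.n₃ - 2) * derivative p - q ^ (E.n₃ - 2) * derivative q).coeff (D - r + m) =
      if (E.n₃ - 1) * r = D + 1 then
        ((E.n₃ - 2 : ℕ) * r + m) * p.coeff r ^ (E.n₃ - 2) * (p - q).coeff m else 0 := by
  have h1 := E.one_lt_n₁
  have h12 := E.n₁_lt_n₂
  have h23 := E.n₂_lt_n₃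
  -- `(n₃ - 1) p ^ (n₃ - 2) p'` is the derivative of `p ^ (n₃ - 1)`.
  have hn : ((E.n₃ - 1 : ℕ) : K) ≠ 0 := Nat.cast_ne_zero.mpr (by omega)
  have h : derivative (p ^ (E.n₃ - 1) - q ^ (E.n₃ - 1)) = C ((E.n₃ - 1 : ℕ) : K) *
      (p ^ (E.n₃ - 2) * derivative p - q ^ (E.n₃ - 2) * derivative q) := by
    rw [derivative_sub, derivative_pow, derivative_pow,
      show E.n₃ - 1 - 1 = E.n₃ - 2 by omega]
    ring
  have h' := congrArg (fun f => coeff f (D - r + m)) h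
  simp only [coeff_derivative, coeff_C_mul] at h'
  apply mul_left_cancel₀ hn
  rw [← h']
  have hle := natDegree_pow_sub_pow_le hp hq hm (show 0 < E.n₃ - 1 by omega)
  have hco := coeff_pow_sub_pow hp hq hm hc (k := E.n₃ - 1)
  rw [show E.n₃ - 1 - 1 = E.n₃ - 2 by omega] at hle hco
  have hmul : (E.n₃ - 1) * r = (E.n₃ - 2) * r + r := by
    rw [show E.n₃ - 1 = E.n₃ - 2 + 1 by omega, add_mul, one_mul]
  have hpos : 0 < (E.n₃ - 2) * r := Nat.mul_pos (by omega) hr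
  split_ifs with hif
  · have hN : D - r + m + 1 = (E.n₃ - 2) * r + m := by omega
    have hN' : ((D - r + m : ℕ) : K) + 1 = (E.n₃ - 2 : ℕ) * r + m := by exact_mod_cast hN
    rw [hN, hN', hco]
    ring
  · rw [coeff_eq_zero_of_natDegree_lt (by omega)]
    ring

/-- Two denominators of the same degree and leading coefficient `c` differ by a polynomial of some
degree `m < r`; comparing the top coefficients in the difference of the two identities gives
`P_r'(1/c) = 0` if `∂ ∉ T_r` and `P_r'(1/c) = m - r` if `∂ ∈ T_r`. -/
theorem eq_of_leadingCoeff_eq [CharZero K] {E : AbelEq K} {p q : K[X]}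
    (hp : p ∈ E.denominators) (hq : q ∈ E.denominators) (hdeg : q.natDegree = p.natDegree)
    (hlc : q.leadingCoeff = p.leadingCoeff) (h₁ : E.ND1 p.natDegree) (h₂ : E.ND2 p.natDegree) :
    p = q := by
  have o1 := E.one_lt_n₁
  have o12 := E.n₁_lt_n₂
  have o23 := E.n₂_lt_n₃
  have hr := hp.1
  set r := p.natDegree with hrdef
  have hroot := eval_P_inv_leadingCoeff hp
  rw [← hrdef] at hroot
  have hc0 : p.leadingCoeff ≠ 0 := leadingCoeff_ne_zero.mpr (ne_zero_of_natDegree_gt hp.1)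
  have hcp : p.coeff r = p.leadingCoeff := rfl
  have hcq : q.coeff r = p.coeff r := by rw [hcp, ← hlc, leadingCoeff, hdeg]
  obtain ⟨D, hD⟩ := E.exists_isTopDegree hr
  by_contra hne
  have hsub : p - q ≠ 0 := sub_ne_zero.mpr hne
  set m := (p - q).natDegree with hmdef
  have hmr : m < r := by
    refine lt_of_le_of_ne
      ((natDegree_sub_le_of_le hrdef.ge hdeg.le).trans_eq (max_self r)) fun he => ?_
    have : (p - q).coeff m = 0 := by rw [he, coeff_sub, hcq, sub_self]
    exact hsub (leadingCoeff_eq_zero.mp this)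
  have hm0 : (p - q).coeff m ≠ 0 := leadingCoeff_ne_zero.mpr hsub
  have hdiff : E.A₂ * (p ^ (E.n₃ - E.n₂) - q ^ (E.n₃ - E.n₂)) +
      E.A₁ * (p ^ (E.n₃ - E.n₁) - q ^ (E.n₃ - E.n₁)) +
      (p ^ (E.n₃ - 2) * derivative p - q ^ (E.n₃ - 2) * derivative q) = 0 := by
    linear_combination hp.2 - hq.2
  have hco := congrArg (fun f => coeff f (D - r + m)) hdiff
  simp only [coeff_add, coeff_zero] at hco
  rw [coeff_mul_pow_sub_pow le_rfl hdeg.le le_rfl hcq (by omega) hD.le₂,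
    coeff_mul_pow_sub_pow le_rfl hdeg.le le_rfl hcq (by omega) hD.le₁,
    E.coeff_pow_mul_derivative_sub hr le_rfl hdeg.le le_rfl hcq hD.led, hcp] at hco
  have hG := hD.eval_P_inv_mul hc0
  rw [hroot, zero_mul] at hG
  have hP' := congrArg (fun f => (derivative f).eval p.leadingCoeff⁻¹) hD.P_eq
  have hx0 : p.leadingCoeff⁻¹ ≠ 0 := inv_ne_zero hc0
  generalize p.leadingCoeff = c at *
  simp only [derivative_add, derivative_C_mul, derivative_X_pow, derivative_X, eval_add, eval_mul,
    eval_C, eval_pow, eval_X, mul_one] at hP'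
  -- Everything is multiplied by `c ^ (n₃ - 1)` to turn the powers of `c⁻¹` in `P_r'(c⁻¹)` into the
  -- powers of `c` in `hco` and `hG`.
  have hinv : ∀ n, 0 < n → n ≤ E.n₃ → c⁻¹ ^ (n - 1) * c ^ (E.n₃ - 1) = c ^ (E.n₃ - n) := by
    intro n h0 hn
    rw [show E.n₃ - 1 = (n - 1) + (E.n₃ - n) by omega, pow_add, ← mul_assoc, ← mul_pow,
      inv_mul_cancel₀ hc0, one_pow, one_mul]
  have hsucc : ∀ k, 0 < k → c ^ (k - 1) * c = c ^ k := fun k hk => by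
    rw [← pow_succ, Nat.sub_add_cancel hk]
  have i₃ := hinv E.n₃ (by omega) le_rfl
  have i₂ := hinv E.n₂ (by omega) o23.le
  have i₁ := hinv E.n₁ (by omega) (by omega)
  have s₂ := hsucc (E.n₃ - E.n₂) (by omega)
  have s₁ := hsucc (E.n₃ - E.n₁) (by omega)
  have s := hsucc (E.n₃ - 1) (by omega)
  rw [show E.n₃ - 1 - 1 = E.n₃ - 2 by omega] at s
  rw [Nat.sub_self, pow_zero] at i₃
  have n₂ : ((E.n₃ - E.n₂ : ℕ) : K) = E.n₃ - E.n₂ := Nat.cast_sub o23.le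
  have n₁ : ((E.n₃ - E.n₁ : ℕ) : K) = E.n₃ - E.n₁ := Nat.cast_sub (by omega)
  have n : ((E.n₃ - 2 : ℕ) : K) = E.n₃ - 2 := by
    rw [Nat.cast_sub (by omega)]; simp
  rw [n₂, n₁] at hco
  have hcpow : c ^ (E.n₃ - 1) ≠ 0 := pow_ne_zero _ hc0
  by_cases htie : (E.n₃ - 1) * r = D + 1
  · rw [if_pos htie, n] at hco
    rw [derivTie, if_pos htie] at hG hP'
    refine h₂ (hD.memd.mpr htie) c⁻¹ hx0 hroot (m - r) (by omega) ?_
    push_cast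
    apply mul_right_cancel₀ (mul_ne_zero hm0 hcpow)
    linear_combination ((p - q).coeff m * c ^ (E.n₃ - 1)) * hP' - c * hco
      + (p - q).coeff m * (E.n₃ * E.A₃.coeff D * i₃
      + E.n₂ * E.A₂.coeff (D - (E.n₃ - E.n₂) * r) * i₂
      + E.n₁ * E.A₁.coeff (D - (E.n₃ - E.n₁) * r) * i₁)
      - (p - q).coeff m * E.n₃ * hG
      + (p - q).coeff m * ((E.n₃ - E.n₂) * E.A₂.coeff (D - (E.n₃ - E.n₂) * r) * s₂
      + (E.n₃ - E.n₁) * E.A₁.coeff (D - (E.n₃ - E.n₁) * r) * s₁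
      + ((E.n₃ - 2) * r + m) * s)
  · rw [if_neg htie] at hco
    rw [derivTie, if_neg htie] at hG hP'
    refine h₁.eval_derivative_P_ne_zero hr hx0 hroot ?_
    apply mul_right_cancel₀ (mul_ne_zero hm0 hcpow)
    linear_combination ((p - q).coeff m * c ^ (E.n₃ - 1)) * hP' - c * hco
      + (p - q).coeff m * (E.n₃ * E.A₃.coeff D * i₃
      + E.n₂ * E.A₂.coeff (D - (E.n₃ - E.n₂) * r) * i₂
      + E.n₁ * E.A₁.coeff (D - (E.n₃ - E.n₁) * r) * i₁)
      - (p - q).coeff m * E.n₃ * hG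
      + (p - q).coeff m * ((E.n₃ - E.n₂) * E.A₂.coeff (D - (E.n₃ - E.n₂) * r) * s₂
      + (E.n₃ - E.n₁) * E.A₁.coeff (D - (E.n₃ - E.n₁) * r) * s₁)

/-! ### Two solutions force one of the three alternatives -/

/-- Distinct denominators of degree at most `r`, one of them of degree exactly `r`, have
coefficients at `t ^ r` whose `k`-th powers differ, for the three exponents `k` that matter. -/
theorem coeff_pow_ne [CharZero K] {E : AbelEq K} (hND : E.ND) {p q : K[X]}
    (hp : p ∈ E.denominators) (hq : q ∈ E.denominators) (hne : p ≠ q)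
    (hle : q.natDegree ≤ p.natDegree) {k : ℕ}
    (hk : k = E.n₃ - E.n₂ ∨ k = E.n₃ - E.n₁ ∨ k = E.n₃ - 1) :
    p.coeff p.natDegree ^ k ≠ q.coeff p.natDegree ^ k := by
  have h1 := E.one_lt_n₁
  have h12 := E.n₁_lt_n₂
  have h23 := E.n₂_lt_n₃
  have hpc : p.leadingCoeff ≠ 0 := leadingCoeff_ne_zero.mpr (ne_zero_of_natDegree_gt hp.1)
  have hqc : q.leadingCoeff ≠ 0 := leadingCoeff_ne_zero.mpr (ne_zero_of_natDegree_gt hq.1)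
  intro h
  rcases hle.lt_or_eq with hlt | heq
  · rw [coeff_eq_zero_of_natDegree_lt hlt, zero_pow (by omega)] at h
    exact pow_ne_zero _ hpc h
  · obtain ⟨nd₁, nd₂, nd₃⟩ := hND _ (natDegree_mem_Gamma hp) (edgeAdmissible_of_mem_denominators hp)
    have hPq := eval_P_inv_leadingCoeff hq
    rw [heq] at hPq
    rw [← heq, coeff_natDegree, heq, coeff_natDegree] at h
    have hinv := nd₃.eq_of_pow_eq_pow hp.1 (inv_ne_zero hpc) (inv_ne_zero hqc)
      (eval_P_inv_leadingCoeff hp) hPq hk (by rw [inv_pow, inv_pow, h])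
    exact hne (eq_of_leadingCoeff_eq hp hq heq (inv_injective hinv).symm nd₁ nd₂)

/-- In the difference of the identities of two denominators the `A₃` term cancels, so that the
largest of the three remaining formal degrees `u`, `v`, `w - 1` is attained at least twice. -/
theorem degree_ties [CharZero K] {E : AbelEq K} (hND : E.ND) {p q : K[X]}
    (hp : p ∈ E.denominators) (hq : q ∈ E.denominators) (hne : p ≠ q)
    (hle : q.natDegree ≤ p.natDegree) {u v w : ℕ}
    (hu : E.a₂ + (E.n₃ - E.n₂) * p.natDegree = u) (hv : E.a₁ + (E.n₃ - E.n₁) * p.natDegree = v)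
    (hw : (E.n₃ - 1) * p.natDegree = w) :
    (v + 1 < w ∧ u + 1 = w) ∨ (w < v + 1 ∧ u = v) ∨ (v + 1 = w ∧ u + 1 ≤ w) := by
  have hr := hp.1
  have hdiff : E.A₂ * p ^ (E.n₃ - E.n₂) + E.A₁ * p ^ (E.n₃ - E.n₁) +
      p ^ (E.n₃ - 2) * derivative p = E.A₂ * q ^ (E.n₃ - E.n₂) + E.A₁ * q ^ (E.n₃ - E.n₁) +
      q ^ (E.n₃ - 2) * derivative q := by
    linear_combination hp.2 - hq.2
  have key : ∀ D, u ≤ D → v ≤ D → w ≤ D + 1 →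
      E.A₂.coeff (D - (E.n₃ - E.n₂) * p.natDegree) *
        (p.coeff p.natDegree ^ (E.n₃ - E.n₂) - q.coeff p.natDegree ^ (E.n₃ - E.n₂)) +
      E.A₁.coeff (D - (E.n₃ - E.n₁) * p.natDegree) *
        (p.coeff p.natDegree ^ (E.n₃ - E.n₁) - q.coeff p.natDegree ^ (E.n₃ - E.n₁)) +
      E.derivTie p.natDegree D *
        (p.coeff p.natDegree ^ (E.n₃ - 1) - q.coeff p.natDegree ^ (E.n₃ - 1)) = 0 := by
    intro D hu' hv' hw'
    rw [← hu, a₂] at hu'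
    rw [← hv, a₁] at hv'
    rw [← hw] at hw'
    have h := congrArg (fun f => coeff f D) hdiff
    simp only [coeff_add] at h
    rw [coeff_mul_pow_eq le_rfl hu', coeff_mul_pow_eq le_rfl hv',
      E.coeff_pow_mul_derivative le_rfl hw', coeff_mul_pow_eq hle hu', coeff_mul_pow_eq hle hv',
      E.coeff_pow_mul_derivative hle hw'] at h
    linear_combination h
  have z₂ : ∀ D, u < D → E.A₂.coeff (D - (E.n₃ - E.n₂) * p.natDegree) = 0 := fun D h =>
    coeff_eq_zero_of_natDegree_lt (by rw [← hu, a₂] at h; omega)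
  have z₁ : ∀ D, v < D → E.A₁.coeff (D - (E.n₃ - E.n₁) * p.natDegree) = 0 := fun D h =>
    coeff_eq_zero_of_natDegree_lt (by rw [← hv, a₁] at h; omega)
  have z : ∀ D, w ≠ D + 1 → E.derivTie p.natDegree D = 0 := fun D h => by
    rw [derivTie, hw, if_neg h]
  have d₂ := sub_ne_zero.mpr (coeff_pow_ne hND hp hq hne hle (.inl rfl))
  have d₁ := sub_ne_zero.mpr (coeff_pow_ne hND hp hq hne hle (.inr (.inl rfl)))
  have d := sub_ne_zero.mpr (coeff_pow_ne hND hp hq hne hle (.inr (.inr rfl)))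
  by_contra hcon
  have hcases : (v < u ∧ w < u + 1) ∨ (u < v ∧ w < v + 1) ∨ (u + 1 < w ∧ v + 1 < w) := by omega
  rcases hcases with ⟨i, j⟩ | ⟨i, j⟩ | ⟨i, j⟩
  · have h := key u le_rfl i.le j.le
    rw [z₁ u i, z u j.ne, zero_mul, zero_mul, add_zero, add_zero, ← hu, Nat.add_sub_cancel] at h
    exact mul_ne_zero (leadingCoeff_ne_zero.mpr E.A₂_ne_zero) d₂ h
  · have h := key v i.le le_rfl j.le
    rw [z₂ v i, z v j.ne, zero_mul, zero_mul, add_zero, zero_add, ← hv, Nat.add_sub_cancel] at h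
    exact mul_ne_zero (leadingCoeff_ne_zero.mpr E.A₁_ne_zero) d₁ h
  · have h := key (w - 1) (by omega) (by omega) (by omega)
    rw [z₂ _ (by omega), z₁ _ (by omega), zero_mul, zero_mul, add_zero, zero_add, derivTie, hw,
      if_pos (by omega)] at h
    exact mul_ne_zero (Nat.cast_ne_zero.mpr hr.ne') d h

theorem alternatives_iff {E : AbelEq K} {r u v w : ℕ} (hu : E.a₂ + (E.n₃ - E.n₂) * r = u)
    (hv : E.a₁ + (E.n₃ - E.n₁) * r = v) (hw : (E.n₃ - 1) * r = w) :
    (E.C1 r ↔ v + 1 < w ∧ u + 1 = w) ∧ (E.C2 r ↔ w < v + 1 ∧ u = v) ∧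
      (E.C3 r ↔ v + 1 = w ∧ u + 1 ≤ w) := by
  have h1 := E.one_lt_n₁
  have h12 := E.n₁_lt_n₂
  have h23 := E.n₂_lt_n₃
  have e₂ : (u : ℤ) = E.a₂ + E.n₃ * r - E.n₂ * r := by
    rw [← hu]; push_cast [Nat.cast_sub h23.le]; ring
  have e₁ : (v : ℤ) = E.a₁ + E.n₃ * r - E.n₁ * r := by
    rw [← hv]; push_cast [Nat.cast_sub (h12.trans h23).le]; ring
  have e : (w : ℤ) = E.n₃ * r - r := by
    rw [← hw]; push_cast [Nat.cast_sub (show 1 ≤ E.n₃ by omega)]; ring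
  simp only [C1, C2, C3, sub_mul, one_mul]
  omega

/-! ### Tie sets -/

theorem exists_mem_T_ne {E : AbelEq K} {r : ℕ} (h : E.EdgeAdmissible r) (l : Vertex) :
    ∃ k ∈ E.T r, k ≠ l := Finset.exists_mem_ne h.2 l

/-- A binomial tie `{ℓ, ∂}` does not occur at the degree of a denominator. -/
theorem T_ne_pair [CharZero K] {E : AbelEq K} (hND : E.ND) {p : K[X]} (hp : p ∈ E.denominators)
    {l : Vertex} (hl : l ≠ .vd) : E.T p.natDegree ≠ {l, .vd} := by
  have h1 := E.one_lt_n₁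
  have h12 := E.n₁_lt_n₂
  have h23 := E.n₂_lt_n₃
  intro hT
  have hx : p.leadingCoeff⁻¹ ≠ 0 :=
    inv_ne_zero (leadingCoeff_ne_zero.mpr (ne_zero_of_natDegree_gt hp.1))
  have nd₂ := (hND _ (natDegree_mem_Gamma hp) (edgeAdmissible_of_mem_denominators hp)).2.1
  obtain ⟨a, -, ha⟩ := E.exists_edgeTerm_eq hp.1 l
  refine nd₂.P_ne_binomial hp.1 (by simp [hT]) hx (eval_P_inv_leadingCoeff hp)
    (n := E.exponent l) (by cases l <;> simp only [exponent] <;> first | omega | exact absurd rfl hl)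
    a ?_
  rw [P, hT, Finset.sum_pair hl, ha]
  rfl

theorem T_of_C1 [CharZero K] {E : AbelEq K} (hND : E.ND) {p : K[X]} (hp : p ∈ E.denominators)
    (h : E.C1 p.natDegree) : E.T p.natDegree = {.v3, .v2, .vd} := by
  obtain ⟨i, j⟩ := (alternatives_iff rfl rfl rfl).1.mp h
  obtain ⟨D, hD⟩ := E.exists_isTopDegree hp.1
  obtain ⟨k, hk, hk3⟩ := exists_mem_T_ne (edgeAdmissible_of_mem_denominators hp) .v3
  have hpair := T_ne_pair hND hp (l := .v2) (by decide)
  have := hD.le₂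
  have := hD.led
  have m₁ := hD.mem₁
  have m₂ := hD.mem₂
  have m := hD.memd
  have hDu : E.a₂ + (E.n₃ - E.n₂) * p.natDegree = D := by
    cases k
    · exact absurd rfl hk3
    · exact m₂.mp hk
    · have := m₁.mp hk
      omega
    · have := m.mp hk
      omega
  have t₂ : Vertex.v2 ∈ E.T p.natDegree := m₂.mpr hDu
  have t₁ : Vertex.v1 ∉ E.T p.natDegree := fun h => by have := m₁.mp h; omega
  have t : Vertex.vd ∈ E.T p.natDegree := m.mpr (by omega)
  have t₃ : Vertex.v3 ∈ E.T p.natDegree := by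
    by_contra t₃
    exact hpair (by ext l; cases l <;> simp [t₁, t₂, t₃, t])
  ext l
  cases l <;> simp [t₁, t₂, t₃, t]

theorem T_of_C2 [CharZero K] {E : AbelEq K} {p : K[X]} (hp : p ∈ E.denominators)
    (h : E.C2 p.natDegree) :
    E.T p.natDegree = {.v2, .v1} ∨ E.T p.natDegree = {.v3, .v2, .v1} := by
  obtain ⟨i, j⟩ := (alternatives_iff rfl rfl rfl).2.1.mp h
  obtain ⟨D, hD⟩ := E.exists_isTopDegree hp.1
  obtain ⟨k, hk, hk3⟩ := exists_mem_T_ne (edgeAdmissible_of_mem_denominators hp) .v3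
  have := hD.le₂
  have m₁ := hD.mem₁
  have m₂ := hD.mem₂
  have m := hD.memd
  have hDu : E.a₂ + (E.n₃ - E.n₂) * p.natDegree = D := by
    cases k
    · exact absurd rfl hk3
    · exact m₂.mp hk
    · have := m₁.mp hk
      omega
    · have := m.mp hk
      omega
  have t₂ : Vertex.v2 ∈ E.T p.natDegree := m₂.mpr hDu
  have t₁ : Vertex.v1 ∈ E.T p.natDegree := m₁.mpr (by omega)
  have t : Vertex.vd ∉ E.T p.natDegree := fun h => by have := m.mp h; omega
  by_cases t₃ : Vertex.v3 ∈ E.T p.natDegree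
  · right
    ext l
    cases l <;> simp [t₁, t₂, t₃, t]
  · left
    ext l
    cases l <;> simp [t₁, t₂, t₃, t]

theorem T_of_C3 [CharZero K] {E : AbelEq K} (hND : E.ND) {p : K[X]} (hp : p ∈ E.denominators)
    (h : E.C3 p.natDegree) :
    E.T p.natDegree = {.v2, .v1, .vd} ∨ E.T p.natDegree = {.v3, .v1, .vd} ∨
      E.T p.natDegree = {.v3, .v2, .v1, .vd} := by
  obtain ⟨i, j⟩ := (alternatives_iff rfl rfl rfl).2.2.mp h
  obtain ⟨D, hD⟩ := E.exists_isTopDegree hp.1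
  obtain ⟨k, hk, hk3⟩ := exists_mem_T_ne (edgeAdmissible_of_mem_denominators hp) .v3
  have hpair := T_ne_pair hND hp (l := .v1) (by decide)
  have := hD.le₁
  have := hD.led
  have m₁ := hD.mem₁
  have m₂ := hD.mem₂
  have m := hD.memd
  have hDv : E.a₁ + (E.n₃ - E.n₁) * p.natDegree = D := by
    cases k
    · exact absurd rfl hk3
    · have := m₂.mp hk
      omega
    · exact m₁.mp hk
    · have := m.mp hk
      omega
  have t₁ : Vertex.v1 ∈ E.T p.natDegree := m₁.mpr hDv
  have t : Vertex.vd ∈ E.T p.natDegree := m.mpr (by omega)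
  by_cases t₃ : Vertex.v3 ∈ E.T p.natDegree <;> by_cases t₂ : Vertex.v2 ∈ E.T p.natDegree
  · right; right
    ext l
    cases l <;> simp [t₁, t₂, t₃, t]
  · right; left
    ext l
    cases l <;> simp [t₁, t₂, t₃, t]
  · left
    ext l
    cases l <;> simp [t₁, t₂, t₃, t]
  · exact absurd (by ext l; cases l <;> simp [t₁, t₂, t₃, t]) hpair

/-- For a denominator of degree `s < r`, the terms other than `A₃` have degree less than
`n₃ r - Φ_3(r) = a₃` if `3 ∈ T_r`, so that nothing could cancel `A₃`. -/
theorem natDegree_eq_of_v3_mem_T [CharZero K] {E : AbelEq K} {r : ℕ}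
    (h : Vertex.v3 ∈ E.T r) {q : K[X]} (hq : q ∈ E.denominators) (hle : q.natDegree ≤ r) :
    q.natDegree = r := by
  have h1 := E.one_lt_n₁
  have h12 := E.n₁_lt_n₂
  have h23 := E.n₂_lt_n₃
  by_contra hne
  have hlt : q.natDegree < r := lt_of_le_of_ne hle hne
  obtain ⟨D, hD⟩ := E.exists_isTopDegree (hq.1.trans hlt)
  obtain ⟨D', hD'⟩ := E.exists_isTopDegree hq.1
  obtain ⟨k, hk, hk3⟩ := exists_mem_T_ne (edgeAdmissible_of_mem_denominators hq) .v3
  have e := hD.mem₃.mp h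
  have f₃ := hD'.le₃
  have f₂ := hD.le₂
  have f₁ := hD.le₁
  have f := hD.led
  have g₂ := Nat.mul_lt_mul_of_pos_left hlt (show 0 < E.n₃ - E.n₂ by omega)
  have g₁ := Nat.mul_lt_mul_of_pos_left hlt (show 0 < E.n₃ - E.n₁ by omega)
  have g := Nat.mul_lt_mul_of_pos_left hlt (show 0 < E.n₃ - 1 by omega)
  cases k
  · exact hk3 rfl
  · have := hD'.mem₂.mp hk
    omega
  · have := hD'.mem₁.mp hk
    omega
  · have := hD'.memd.mp hk
    omega

/-- If `2` and `1` tie at the top for `r`, then below `r` the term `2` strictly dominates `1` and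
`∂`, so that only `3` is left to balance it. -/
theorem T_eq_of_lt [CharZero K] {E : AbelEq K} {r : ℕ} (h₂ : Vertex.v2 ∈ E.T r)
    (h₁ : Vertex.v1 ∈ E.T r) {q : K[X]} (hq : q ∈ E.denominators) (hlt : q.natDegree < r) :
    E.T q.natDegree = {.v3, .v2} := by
  have o1 := E.one_lt_n₁
  have o12 := E.n₁_lt_n₂
  have o23 := E.n₂_lt_n₃
  obtain ⟨D, hD⟩ := E.exists_isTopDegree (hq.1.trans hlt)
  obtain ⟨D', hD'⟩ := E.exists_isTopDegree hq.1
  obtain ⟨k, hk, hk3⟩ := exists_mem_T_ne (edgeAdmissible_of_mem_denominators hq) .v3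
  obtain ⟨l, hl, hl2⟩ := exists_mem_T_ne (edgeAdmissible_of_mem_denominators hq) .v2
  obtain ⟨e, he⟩ := Nat.exists_eq_add_of_lt hlt
  have he' : r = q.natDegree + (e + 1) := he
  have f₂ := hD.mem₂.mp h₂
  have f₁ := hD.mem₁.mp h₁
  have f := hD.led
  rw [he', mul_add] at f₂ f₁ f
  have g₂ : (E.n₃ - E.n₂) * (e + 1) < (E.n₃ - E.n₁) * (e + 1) :=
    Nat.mul_lt_mul_of_pos_right (by omega) (by omega)
  have g₁ : (E.n₃ - E.n₁) * (e + 1) < (E.n₃ - 1) * (e + 1) :=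
    Nat.mul_lt_mul_of_pos_right (by omega) (by omega)
  have k₂ := hD'.le₂
  have t₁ : Vertex.v1 ∉ E.T q.natDegree := fun h => by have := hD'.mem₁.mp h; omega
  have t : Vertex.vd ∉ E.T q.natDegree := fun h => by have := hD'.memd.mp h; omega
  have t₂ : Vertex.v2 ∈ E.T q.natDegree := by cases k <;> simp_all
  have t₃ : Vertex.v3 ∈ E.T q.natDegree := by cases l <;> simp_all
  ext l
  cases l <;> simp [t₁, t₂, t₃, t]

theorem eq_of_T_eq_v3_v2 {E : AbelEq K} {s s' : ℕ} (hs : 0 < s) (hs' : 0 < s')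
    (h : E.T s = {.v3, .v2}) (h' : E.T s' = {.v3, .v2}) : s = s' := by
  have o23 := E.n₂_lt_n₃
  obtain ⟨D, hD⟩ := E.exists_isTopDegree hs
  obtain ⟨D', hD'⟩ := E.exists_isTopDegree hs'
  have e₃ := hD.mem₃.mp (by simp [h])
  have e₂ := hD.mem₂.mp (by simp [h])
  have e₃' := hD'.mem₃.mp (by simp [h'])
  have e₂' := hD'.mem₂.mp (by simp [h'])
  exact Nat.eq_of_mul_eq_mul_left (show 0 < E.n₃ - E.n₂ by omega) (by omega)

/-! ### Counting -/

theorem encard_denominators_natDegree_le [CharZero K] {E : AbelEq K} (hND : E.ND) {s j N : ℕ}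
    (hs : 0 < s) (h : ∀ l ∈ E.T s, j ≤ E.exponent l ∧ E.exponent l ≤ N) :
    {p ∈ E.denominators | p.natDegree = s}.encard ≤ (N - j : ℕ) := by
  classical
  choose a ha0 ha using fun k => E.exists_edgeTerm_eq hs k
  have hdvd : X ^ j ∣ E.P s := Finset.dvd_sum fun l hl => by
    rw [ha]
    exact (pow_dvd_pow X (h l hl).1).mul_left _
  have hdeg : (E.P s).natDegree ≤ N := natDegree_sum_le_of_forall_le _ _ fun l hl => by
    rw [ha]
    exact (natDegree_C_mul_X_pow_le _ _).trans (h l hl).2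
  obtain ⟨g, hg⟩ := hdvd
  have hP := E.P_ne_zero hs
  have hg0 : g ≠ 0 := fun h => hP (by rw [hg, h, mul_zero])
  have hgdeg : g.natDegree ≤ N - j := by
    rw [hg, natDegree_X_pow_mul j hg0] at hdeg
    omega
  have hcard : g.roots.toFinset.card ≤ N - j :=
    (Multiset.toFinset_card_le _).trans ((card_roots' g).trans hgdeg)
  refine le_trans (Set.encard_le_encard_of_injOn (t := (g.roots.toFinset : Set K))
    (f := fun p => p.leadingCoeff⁻¹) ?_ ?_) ?_
  · rintro p ⟨hp, rfl⟩
    have hc : p.leadingCoeff⁻¹ ≠ 0 :=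
      inv_ne_zero (leadingCoeff_ne_zero.mpr (ne_zero_of_natDegree_gt hp.1))
    have h0 := eval_P_inv_leadingCoeff hp
    rw [hg, eval_mul, eval_pow, eval_X] at h0
    simpa [hg0] using (mul_eq_zero.mp h0).resolve_left (pow_ne_zero _ hc)
  · rintro p ⟨hp, rfl⟩ q ⟨hq, hqs⟩ hpq
    obtain ⟨nd₁, nd₂, -⟩ :=
      hND _ (natDegree_mem_Gamma hp) (edgeAdmissible_of_mem_denominators hp)
    exact eq_of_leadingCoeff_eq hp hq hqs (inv_injective hpq).symm nd₁ nd₂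
  · rw [Set.encard_coe_eq_coe_finsetCard]
    exact_mod_cast hcard

theorem encard_le_of_v3_mem_T [CharZero K] {E : AbelEq K} (hND : E.ND) {r j N : ℕ}
    (hr : 0 < r) (hmax : ∀ q ∈ E.denominators, q.natDegree ≤ r) (h₃ : Vertex.v3 ∈ E.T r)
    (h : ∀ l ∈ E.T r, j ≤ E.exponent l ∧ E.exponent l ≤ N) :
    E.denominators.encard ≤ (N - j : ℕ) :=
  (Set.encard_le_encard fun q hq =>
    (⟨hq, natDegree_eq_of_v3_mem_T h₃ hq (hmax q hq)⟩ : q ∈ {p ∈ E.denominators | _})).trans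
    (encard_denominators_natDegree_le hND hr h)

/-- Below the maximal degree `r` there is only one further degree `s` with denominators, and it has
`T_s = {3, 2}`. -/
theorem encard_le_of_v2_v1_mem_T [CharZero K] {E : AbelEq K} (hND : E.ND) {r j N : ℕ}
    (hr : 0 < r) (hmax : ∀ q ∈ E.denominators, q.natDegree ≤ r) (h₂ : Vertex.v2 ∈ E.T r)
    (h₁ : Vertex.v1 ∈ E.T r) (h : ∀ l ∈ E.T r, j ≤ E.exponent l ∧ E.exponent l ≤ N) :
    E.denominators.encard ≤ ((N - j) + (E.n₃ - E.n₂) : ℕ) := by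
  have o23 := E.n₂_lt_n₃
  have htop := encard_denominators_natDegree_le hND hr h
  have hbelow : {q ∈ E.denominators | q.natDegree < r}.encard ≤ (E.n₃ - E.n₂ : ℕ) := by
    rcases Set.eq_empty_or_nonempty {q ∈ E.denominators | q.natDegree < r} with he | ⟨q, hq, hqr⟩
    · rw [he]; simp
    · have hT := T_eq_of_lt h₂ h₁ hq hqr
      refine (Set.encard_le_encard fun p hp => (⟨hp.1, ?_⟩ :
        p ∈ {p ∈ E.denominators | p.natDegree = q.natDegree})).trans
        (encard_denominators_natDegree_le hND hq.1 ?_)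
      · exact eq_of_T_eq_v3_v2 hp.1.1 hq.1 (T_eq_of_lt h₂ h₁ hp.1 hp.2) hT
      · intro l hl
        rw [hT] at hl
        cases l <;> simp [exponent] at hl ⊢ <;> omega
  have hsub : E.denominators ⊆ {p ∈ E.denominators | p.natDegree = r} ∪
      {q ∈ E.denominators | q.natDegree < r} := fun q hq =>
    (hmax q hq).eq_or_lt.imp (fun e => ⟨hq, e⟩) (fun e => ⟨hq, e⟩)
  push_cast
  exact (Set.encard_le_encard hsub).trans
    ((Set.encard_union_le _ _).trans (add_le_add htop hbelow))

/-- The largest degree of a denominator exists because all these degrees are at most `a₃`. -/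
theorem exists_max_natDegree {E : AbelEq K} (h : E.denominators.Nonempty) :
    ∃ p ∈ E.denominators, ∀ q ∈ E.denominators, q.natDegree ≤ p.natDegree := by
  have hbdd : BddAbove (natDegree '' E.denominators) := by
    refine ⟨E.a₃, ?_⟩
    rintro _ ⟨p, hp, rfl⟩
    have o23 := E.n₂_lt_n₃
    exact (Nat.le_mul_of_pos_left _ (by omega)).trans (mul_natDegree_le hp)
  obtain ⟨p, hp, hpe⟩ := Nat.sSup_mem (h.image natDegree) hbdd
  exact ⟨p, hp, fun q hq => hpe ▸ le_csSup hbdd ⟨q, hq, rfl⟩⟩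

end AbelEq

theorem proposition6p3 {𝕜 : Type*} [RCLike 𝕜] (E : AbelEq 𝕜) (hND : E.ND)
    (htwo : E.solutions.Nontrivial) :
    ∃ r : ℕ, IsGreatest E.GammaSol r ∧
      -- exactly one of the three alternatives holds at `r`
      ((E.C1 r ∧ ¬ E.C2 r ∧ ¬ E.C3 r) ∨ (¬ E.C1 r ∧ E.C2 r ∧ ¬ E.C3 r) ∨
        (¬ E.C1 r ∧ ¬ E.C2 r ∧ E.C3 r)) ∧
      -- the possible tie sets in the three alternatives
      (E.C1 r → E.T r = {.v3, .v2, .vd}) ∧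
      (E.C2 r → E.T r = {.v2, .v1} ∨ E.T r = {.v3, .v2, .v1}) ∧
      (E.C3 r → E.T r = {.v2, .v1, .vd} ∨ E.T r = {.v3, .v1, .vd} ∨
        E.T r = {.v3, .v2, .v1, .vd}) ∧
      -- the bounds
      (E.C1 r → E.S ≤ (E.n₃ - 1 : ℕ)) ∧
      (E.C2 r → E.T r = {.v2, .v1} → E.S ≤ (E.n₃ : ℕ)) ∧
      (E.C2 r → E.T r = {.v3, .v2, .v1} → E.S ≤ (E.n₃ - E.n₁ : ℕ)) ∧
      (E.C3 r → E.T r = {.v2, .v1, .vd} → E.S ≤ ((E.n₂ - 1) + 2 * (E.n₃ - 1) : ℕ)) ∧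
      (E.C3 r → E.T r = {.v3, .v1, .vd} → E.S ≤ (E.n₃ - 1 : ℕ)) ∧
      (E.C3 r → E.T r = {.v3, .v2, .v1, .vd} → E.S ≤ (E.n₃ - 1 : ℕ)) ∧
      E.S ≤ ((E.n₂ - 1) + 2 * (E.n₃ - 1) : ℕ) := by
  have o1 := E.one_lt_n₁
  have o12 := E.n₁_lt_n₂
  have o23 := E.n₂_lt_n₃
  have hnt : E.denominators.Nontrivial := by
    rw [← Set.one_lt_encard_iff_nontrivial, ← E.S_eq_encard_denominators, AbelEq.S,
      Set.one_lt_encard_iff_nontrivial]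
    exact htwo
  obtain ⟨p, hp, hmax⟩ := AbelEq.exists_max_natDegree hnt.nonempty
  obtain ⟨q, hq, hqp⟩ := hnt.exists_ne p
  have hties := AbelEq.degree_ties hND hp hq hqp.symm (hmax q hq) rfl rfl rfl
  obtain ⟨c₁, c₂, c₃⟩ := AbelEq.alternatives_iff (E := E) (r := p.natDegree) rfl rfl rfl
  have hS := E.S_eq_encard_denominators
  have T₁ := AbelEq.T_of_C1 hND hp
  have T₂ := AbelEq.T_of_C2 hp
  have T₃ := AbelEq.T_of_C3 hND hp
  have hr := hp.1
  -- In each application below the exponents of the monomials of `P_r` lie between `j` and `N`.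
  have bound₃ : ∀ j N, Vertex.v3 ∈ E.T p.natDegree →
      (∀ l ∈ E.T p.natDegree, j ≤ E.exponent l ∧ E.exponent l ≤ N) → E.S ≤ (N - j : ℕ) :=
    fun j N h₃ h => hS ▸ AbelEq.encard_le_of_v3_mem_T hND hr hmax h₃ h
  have bound₂₁ : ∀ j N, Vertex.v2 ∈ E.T p.natDegree → Vertex.v1 ∈ E.T p.natDegree →
      (∀ l ∈ E.T p.natDegree, j ≤ E.exponent l ∧ E.exponent l ≤ N) →
      E.S ≤ ((N - j) + (E.n₃ - E.n₂) : ℕ) :=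
    fun j N h₂ h₁ h => hS ▸ AbelEq.encard_le_of_v2_v1_mem_T hND hr hmax h₂ h₁ h
  have hgreatest : IsGreatest E.GammaSol p.natDegree := by
    rw [AbelEq.gammaSol_eq_image]
    refine ⟨⟨p, hp, rfl⟩, ?_⟩
    rintro _ ⟨q, hq, rfl⟩
    exact hmax q hq
  clear hS hmax
  have weaken : ∀ {a b : ℕ}, a ≤ b → E.S ≤ a → E.S ≤ b := fun hab h =>
    h.trans (by exact_mod_cast hab)
  generalize p.natDegree = r at *
  have ba : E.T r = {.v3, .v2, .vd} → E.S ≤ (E.n₃ - 1 : ℕ) := fun hT =>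
    bound₃ 1 E.n₃ (by simp [hT]) fun l hl => by
      rw [hT] at hl
      cases l <;> simp [AbelEq.exponent] at hl ⊢ <;> omega
  have bb : E.T r = {.v2, .v1} → E.S ≤ (E.n₃ : ℕ) := fun hT =>
    weaken (by omega) <| bound₂₁ 0 E.n₂ (by simp [hT]) (by simp [hT]) fun l hl => by
      rw [hT] at hl
      cases l <;> simp [AbelEq.exponent] at hl ⊢ <;> omega
  have bc : E.T r = {.v3, .v2, .v1} → E.S ≤ (E.n₃ - E.n₁ : ℕ) := fun hT =>
    bound₃ E.n₁ E.n₃ (by simp [hT]) fun l hl => by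
      rw [hT] at hl
      cases l <;> simp [AbelEq.exponent] at hl ⊢ <;> omega
  have bd : E.T r = {.v2, .v1, .vd} → E.S ≤ ((E.n₂ - 1) + 2 * (E.n₃ - 1) : ℕ) := fun hT =>
    weaken (by omega) <| bound₂₁ 1 E.n₂ (by simp [hT]) (by simp [hT]) fun l hl => by
      rw [hT] at hl
      cases l <;> simp [AbelEq.exponent] at hl ⊢ <;> omega
  have be : E.T r = {.v3, .v1, .vd} → E.S ≤ (E.n₃ - 1 : ℕ) := fun hT =>
    bound₃ 1 E.n₃ (by simp [hT]) fun l hl => by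
      rw [hT] at hl
      cases l <;> simp [AbelEq.exponent] at hl ⊢ <;> omega
  have bf : E.T r = {.v3, .v2, .v1, .vd} → E.S ≤ (E.n₃ - 1 : ℕ) := fun hT =>
    bound₃ 1 E.n₃ (by simp [hT]) fun l hl => by
      rw [hT] at hl
      cases l <;> simp [AbelEq.exponent]
      all_goals omega
  refine ⟨r, hgreatest, ?_, T₁, T₂, T₃, fun h => ba (T₁ h), fun _ => bb, fun _ => bc, fun _ => bd,
    fun _ => be, fun _ => bf, ?_⟩
  · rw [c₁, c₂, c₃]
    omega
  · rw [← c₁, ← c₂, ← c₃] at hties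
    rcases hties with h | h | h
    · exact weaken (by omega) (ba (T₁ h))
    · rcases T₂ h with h | h
      exacts [weaken (by omega) (bb h), weaken (by omega) (bc h)]
    · rcases T₃ h with h | h | h
      exacts [bd h, weaken (by omega) (be h), weaken (by omega) (bf h)]
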